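/- Let $n\ge 0$ and let $A:[0,\infty)\to\mathbb R^{n\times n}$ be continuous. Consider the linear system $x'=A(t)x$ on $[0,\infty)$. A fundamental matrix of it is a matrix solution $\Phi$ of $\Phi'=A\Phi$ with $\Phi(t)$ invertible for all $t\ge 0$. Vector norms are Euclidean and matrix norms are the induced operator norms. *Lyapunov spectrum.* For a fundamental matrix $\Phi$ put $\lambda_j(\Phi)=\limsup_{t\to+\infty}\frac1t\ln\|\Phi(t)e_j\|\in[-\infty,+\infty]$, $j=1,\dots,n$. Call $\Phi$ normal if it minimizes $\sum_{j=1}^n\lambda_j(\Phi)$ among all fundamental matrices of the system; if some exponents are infinite, this means that $\Phi$ has the least possible number of exponents equal to $+\infty$, the largest possible number equal to $-\infty$, and, among the fundamental matrices with these same two numbers, the least sum of the finite exponents. The upper Lyapunov exponents $\lambda_1^s\ge\dots\ge\lambda_n^s$ are the numbers $\lambda_j(\Phi)$ of a normal $\Phi$ in decreasing order. The lower Lyapunov exponents $\lambda_1^i\ge\dots\ge\lambda_n^i$ are the negatives of the upper Lyapunov exponents of the dual system $y'=-A(t)^{T}y$, in decreasing order. Put $$\Sigma_L(A)=\bigcup_{j=1}^n\{\gamma\in\mathbb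 R:\lambda_j^i\le\gamma\le\lambda_j^s\}.$$ *Dichotomy spectra.* The system $x'=A(t)x$ admits a nonuniform exponential dichotomy if there exist a fundamental matrix $\Phi$, a matrix $P$ with $P^2=P$, and constants $\alpha>0$, $M>0$, $\varepsilon\in[0,\alpha)$ such that $$\|\Phi(t)P\Phi(s)^{-1}\|\le Me^{-\alpha(t-s)}e^{\varepsilon s}\quad(0\le s\le t),\qquad \|\Phi(t)(I-P)\Phi(s)^{-1}\|\le Me^{\alpha(t-s)}e^{\varepsilon s}\quad(0\le t\le s).$$ It admits an exponential dichotomy if this holds with $\varepsilon=0$. Let $\Sigma_{NED}(A)$, respectively $\Sigma_{ED}(A)$, be the set of all $\gamma\in\mathbb R$ for which the shifted system $x'=(A(t)-\gamma I)x$ admits no nonuniform exponential dichotomy, respectively no exponential dichotomy. Then $$\Sigma_L(A)\subseteq\Sigma_{NED}(A)\subseteq\Sigma_{ED}(A).$$ -/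

import Mathlib

open Filter Set
open scoped Matrix.Norms.L2Operator

noncomputable section

namespace LinearODE

/-- `Φ` is a fundamental matrix solution of `x' = A(t) x` on `[0, ∞)`: it is differentiable
(one-sidedly at `0`), satisfies `Φ' = A Φ`, and is invertible at every time. -/
def IsFundamentalMatrix {n : ℕ} (A Φ : ℝ → Matrix (Fin n) (Fin n) ℝ) : Prop :=
  (∀ t : ℝ, 0 ≤ t → ∀ i j : Fin n,
    HasDerivWithinAt (fun s => Φ s i j) ((A t * Φ t) i j) (Ici 0) t) ∧
  ∀ t : ℝ, 0 ≤ t → IsUnit (Φ t)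

/-- The exponent of the `j`-th column of `Φ`,
`limsup_{t → +∞} (1 / t) ln ‖Φ(t) e_j‖` with the Euclidean norm, as an extended real number. -/
def colExponent {n : ℕ} (Φ : ℝ → Matrix (Fin n) (Fin n) ℝ) (j : Fin n) : EReal :=
  limsup (fun t : ℝ =>
    ((1 / t * Real.log ‖(WithLp.toLp 2 (fun i => Φ t i j) : EuclideanSpace ℝ (Fin n))‖ : ℝ) : EReal))
    atTop

/-- A fundamental matrix is normal if the sum of its column exponents is minimal among all
fundamental matrices. When all exponents are finite, this is literally minimality of the real sum
(the third condition). To avoid `∞ - ∞` when there are infinite exponents, the formal sum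
`p · (+∞) + q · (-∞) + r` is compared through `p` (to be minimized), `q` (to be maximized) and the
real part `r` (to be minimized when `p` and `q` agree); note that `EReal.toReal` vanishes at the
two infinite values, so that the sums below only see the finite exponents. -/
def IsNormal {n : ℕ} (A Φ : ℝ → Matrix (Fin n) (Fin n) ℝ) : Prop :=
  IsFundamentalMatrix A Φ ∧
  ∀ Ψ : ℝ → Matrix (Fin n) (Fin n) ℝ, IsFundamentalMatrix A Ψ →
    {j | colExponent Φ j = ⊤}.ncard ≤ {j | colExponent Ψ j = ⊤}.ncard ∧
    {j | colExponent Ψ j = ⊥}.ncard ≤ {j | colExponent Φ j = ⊥}.ncard ∧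
    ({j | colExponent Φ j = ⊤}.ncard = {j | colExponent Ψ j = ⊤}.ncard →
      {j | colExponent Φ j = ⊥}.ncard = {j | colExponent Ψ j = ⊥}.ncard →
      ∑ j, (colExponent Φ j).toReal ≤ ∑ j, (colExponent Ψ j).toReal)

/-- `lam 0 ≥ lam 1 ≥ ⋯` are the upper Lyapunov exponents of `x' = A(t) x`: the column exponents of
a normal fundamental matrix, in decreasing order. -/
def IsUpperLyapunovExponents {n : ℕ} (A : ℝ → Matrix (Fin n) (Fin n) ℝ) (lam : Fin n → EReal) :
    Prop :=
  Antitone lam ∧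
  ∃ Φ : ℝ → Matrix (Fin n) (Fin n) ℝ, IsNormal A Φ ∧
    ∃ σ : Equiv.Perm (Fin n), ∀ j, lam j = colExponent Φ (σ j)

/-- `lam 0 ≥ lam 1 ≥ ⋯` are the lower Lyapunov exponents of `x' = A(t) x`: the negatives of the
upper Lyapunov exponents of the dual equation `y' = -A(t)ᵀ y`, in decreasing order. -/
def IsLowerLyapunovExponents {n : ℕ} (A : ℝ → Matrix (Fin n) (Fin n) ℝ) (lam : Fin n → EReal) :
    Prop :=
  ∃ mu : Fin n → EReal, IsUpperLyapunovExponents (fun t => -(A t).transpose) mu ∧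
    ∀ j, lam j = -mu (Fin.rev j)

/-- The Lyapunov spectrum: the union over `j` of the (real) intervals between the `j`-th lower and
the `j`-th upper Lyapunov exponent. -/
def lyapunovSpectrum {n : ℕ} (A : ℝ → Matrix (Fin n) (Fin n) ℝ) : Set ℝ :=
  {x | ∃ lamInf lamSup : Fin n → EReal,
    IsLowerLyapunovExponents A lamInf ∧ IsUpperLyapunovExponents A lamSup ∧
    ∃ j, lamInf j ≤ (x : EReal) ∧ (x : EReal) ≤ lamSup j}

/-- `x' = A(t) x` admits an exponential dichotomy on `[0, ∞)`. The norm is the operator norm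
induced by the Euclidean norm. The constant projection `P` corresponds to the invariant family of
projections `Φ(t) P Φ(t)⁻¹`. -/
def HasExpDichotomy {n : ℕ} (A : ℝ → Matrix (Fin n) (Fin n) ℝ) : Prop :=
  ∃ Φ : ℝ → Matrix (Fin n) (Fin n) ℝ, IsFundamentalMatrix A Φ ∧
  ∃ P : Matrix (Fin n) (Fin n) ℝ, P * P = P ∧
  ∃ α M : ℝ, 0 < α ∧ 0 < M ∧
    (∀ s t : ℝ, 0 ≤ s → s ≤ t →
      ‖Φ t * P * (Φ s)⁻¹‖ ≤ M * Real.exp (-α * (t - s))) ∧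
    (∀ s t : ℝ, 0 ≤ t → t ≤ s →
      ‖Φ t * (1 - P) * (Φ s)⁻¹‖ ≤ M * Real.exp (α * (t - s)))

/-- `x' = A(t) x` admits a nonuniform exponential dichotomy on `[0, ∞)`. -/
def HasNonuniformExpDichotomy {n : ℕ} (A : ℝ → Matrix (Fin n) (Fin n) ℝ) : Prop :=
  ∃ Φ : ℝ → Matrix (Fin n) (Fin n) ℝ, IsFundamentalMatrix A Φ ∧
  ∃ P : Matrix (Fin n) (Fin n) ℝ, P * P = P ∧
  ∃ α M ε : ℝ, 0 < α ∧ 0 < M ∧ 0 ≤ ε ∧ ε < α ∧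
    (∀ s t : ℝ, 0 ≤ s → s ≤ t →
      ‖Φ t * P * (Φ s)⁻¹‖ ≤ M * Real.exp (-α * (t - s)) * Real.exp (ε * s)) ∧
    (∀ s t : ℝ, 0 ≤ t → t ≤ s →
      ‖Φ t * (1 - P) * (Φ s)⁻¹‖ ≤ M * Real.exp (α * (t - s)) * Real.exp (ε * s))

/-- The exponential dichotomy (Sacker–Sell) spectrum. -/
def expDichotomySpectrum {n : ℕ} (A : ℝ → Matrix (Fin n) (Fin n) ℝ) : Set ℝ :=
  {γ | ¬ HasExpDichotomy (fun t => A t - γ • (1 : Matrix (Fin n) (Fin n) ℝ))}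

/-- The nonuniform exponential dichotomy spectrum. -/
def nonuniformExpDichotomySpectrum {n : ℕ} (A : ℝ → Matrix (Fin n) (Fin n) ℝ) : Set ℝ :=
  {γ | ¬ HasNonuniformExpDichotomy (fun t => A t - γ • (1 : Matrix (Fin n) (Fin n) ℝ))}

end LinearODE

end

open Filter Set
open scoped Matrix.Norms.L2Operator

namespace LinearODE

variable {n : ℕ}

/-! Suppose the system shifted by `γ` has a nonuniform dichotomy with data `Φ`, `P`, `α`, `ε`. The
columns of `exp (γ t) Φ(t) P` are solutions with bound `exp ((γ - α) t)`, and those of `exp (-γ t)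
((1 - P) Φ(t)⁻¹)ᵀ` are dual solutions with bound `exp ((-γ - α + ε) t)`. As `ε < α`, this gives
`P.rank` independent solutions of exponent below `γ` and `(1 - P).rank` independent dual ones below
`-γ`. Normal matrices have at least that many such columns (`IsNormal.rank_le_ncard`), so the two
counts add up to at least `n` (`le_ncard_add_ncard`). If `γ` lay between the `j`-th lower and upper
exponents (`j` from `0`), the ordering would allow at most `n - 1 - j` columns of the first kind and
`j` of the second, one too few in total. The second inclusion is the case `ε = 0`. -/

/-- An exponential bound on a column bounds its exponent. -/
theorem colExponent_le_of_norm_le {Φ : ℝ → Matrix (Fin n) (Fin n) ℝ} {j : Fin n} {C β : ℝ}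
    (hpos : ∀ t : ℝ, 0 ≤ t →
      0 < ‖(WithLp.toLp 2 (fun i => Φ t i j) : EuclideanSpace ℝ (Fin n))‖)
    (hle : ∀ t : ℝ, 0 ≤ t →
      ‖(WithLp.toLp 2 (fun i => Φ t i j) : EuclideanSpace ℝ (Fin n))‖ ≤ C * Real.exp (β * t)) :
    colExponent Φ j ≤ (β : EReal) := by
  have hC : 0 < C := by
    have h := (hpos 0 le_rfl).trans_le (hle 0 le_rfl)
    simpa using h
  have hlim : Tendsto (fun t : ℝ => ((1 / t * Real.log C + β : ℝ) : EReal)) atTop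
      (nhds (β : EReal)) := by
    refine (continuous_coe_real_ereal.tendsto β).comp ?_
    have h : Tendsto (fun t : ℝ => 1 / t * Real.log C + β) atTop (nhds (0 * Real.log C + β)) := by
      simpa only [one_div] using (tendsto_inv_atTop_zero.mul_const (Real.log C)).add_const β
    simpa using h
  rw [← hlim.limsup_eq]
  refine limsup_le_limsup ?_
  filter_upwards [eventually_gt_atTop 0] with t ht
  have hlog := Real.log_le_log (hpos t ht.le) (hle t ht.le)
  rw [Real.log_mul hC.ne' (Real.exp_pos _).ne', Real.log_exp] at hlog
  refine EReal.coe_le_coe_iff.2 ?_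
  calc 1 / t * _ ≤ 1 / t * (Real.log C + β * t) := by gcongr
    _ = 1 / t * Real.log C + β := by field_simp

/-- Right multiplication by an invertible constant matrix preserves fundamental matrices. -/
theorem IsFundamentalMatrix.mul_const {A Φ : ℝ → Matrix (Fin n) (Fin n) ℝ}
    (hΦ : IsFundamentalMatrix A Φ) {G : Matrix (Fin n) (Fin n) ℝ} (hG : IsUnit G) :
    IsFundamentalMatrix A (fun t => Φ t * G) := by
  refine ⟨fun t ht i j => ?_, fun t ht => (hΦ.2 t ht).mul hG⟩
  rw [← mul_assoc, Matrix.mul_apply]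
  simp only [Matrix.mul_apply (M := Φ _)]
  exact HasDerivWithinAt.fun_sum fun k _ => (hΦ.1 t ht i k).mul_const (G k j)

/-- Undoing the shift of the system by `γ`. -/
theorem IsFundamentalMatrix.exp_smul {A Φ : ℝ → Matrix (Fin n) (Fin n) ℝ} {γ : ℝ}
    (hΦ : IsFundamentalMatrix (fun t => A t - γ • (1 : Matrix (Fin n) (Fin n) ℝ)) Φ) :
    IsFundamentalMatrix A (fun t => Real.exp (γ * t) • Φ t) := by
  refine ⟨fun t ht i j => ?_, fun t ht => ?_⟩
  · have he : HasDerivWithinAt (fun s : ℝ => Real.exp (γ * s)) (Real.exp (γ * t) * γ) (Ici 0) t := by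
      simpa using (((hasDerivAt_id t).const_mul γ).exp).hasDerivWithinAt
    have h := he.mul (hΦ.1 t ht i j)
    refine h.congr_deriv ?_
    simp only [sub_mul, Matrix.sub_apply, Matrix.smul_mul, one_mul, Matrix.mul_smul,
      Matrix.smul_apply, smul_eq_mul]
    ring
  · exact (hΦ.2 t ht).smul (Units.mk0 _ (Real.exp_pos (γ * t)).ne')

/-- The pairing of a fundamental matrix with one of the dual system is constant. -/
theorem IsFundamentalMatrix.transpose_mul_eq {A X Y : ℝ → Matrix (Fin n) (Fin n) ℝ}
    (hX : IsFundamentalMatrix A X) (hY : IsFundamentalMatrix (fun t => -(A t).transpose) Y)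
    {t : ℝ} (ht : 0 ≤ t) : (Y t).transpose * X t = (Y 0).transpose * X 0 := by
  ext i j
  have hd : ∀ s ∈ Ici (0 : ℝ),
      HasDerivWithinAt (fun s => ((Y s).transpose * X s) i j) 0 (Ici 0) s := by
    intro s hs
    have h := HasDerivWithinAt.fun_sum (u := Finset.univ)
      fun k _ => (hY.1 s hs k i).mul (hX.1 s hs k j)
    simp only [Matrix.mul_apply (M := (Y _).transpose), Matrix.transpose_apply]
    refine h.congr_deriv ?_
    rw [Finset.sum_add_distrib]
    have h1 : ∑ k, (-(A s).transpose * Y s) k i * X s k j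
        = (((-(A s).transpose * Y s).transpose) * X s) i j := by
      rw [Matrix.mul_apply]
      rfl
    have h2 : ∑ k, Y s k i * (A s * X s) k j = ((Y s).transpose * (A s * X s)) i j := by
      rw [Matrix.mul_apply]
      rfl
    rw [h1, h2, ← Matrix.add_apply, Matrix.transpose_mul, Matrix.transpose_neg,
      Matrix.transpose_transpose, mul_neg, neg_mul, mul_assoc, neg_add_cancel, Matrix.zero_apply]
  have hdiff : DifferentiableOn ℝ (fun s => ((Y s).transpose * X s) i j) (Ici 0) :=
    fun s hs => (hd s hs).differentiableWithinAt
  refine (convex_Ici (0 : ℝ)).is_const_of_fderivWithin_eq_zero hdiff (fun s hs => ?_)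
    (mem_Ici.2 ht) (mem_Ici.2 le_rfl)
  have := (hd s hs).hasFDerivWithinAt.fderivWithin (uniqueDiffOn_Ici 0 s hs)
  rw [this]
  ext
  simp

/-- Replacing a column of a normal fundamental matrix by another solution never lowers the
exponent of that column. -/
theorem IsNormal.colExponent_le_of_eq_off {A Φ Ψ : ℝ → Matrix (Fin n) (Fin n) ℝ}
    (hΦ : IsNormal A Φ) (hΨ : IsFundamentalMatrix A Ψ) {j : Fin n}
    (heq : ∀ i ≠ j, colExponent Ψ i = colExponent Φ i) :
    colExponent Φ j ≤ colExponent Ψ j := by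
  by_contra! hlt
  obtain ⟨htop, hbot, hsum⟩ := hΦ.2 Ψ hΨ
  -- An infinite exponent on either side would contradict the counts of `⊤` or `⊥`; the remaining
  -- finite case contradicts the minimal real sum.
  have hΨtop : colExponent Ψ j ≠ ⊤ := hlt.ne_top
  have hΦbot : colExponent Φ j ≠ ⊥ := hlt.ne_bot
  have hΦtop : colExponent Φ j ≠ ⊤ := by
    intro h
    refine htop.not_gt (Set.ncard_lt_ncard ⟨fun i hi => ?_, fun hs => hΨtop (hs h)⟩)
    have hij : i ≠ j := fun e => hΨtop (e ▸ hi)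
    exact (heq i hij).symm.trans hi
  have hΨbot : colExponent Ψ j ≠ ⊥ := by
    intro h
    refine hbot.not_gt (Set.ncard_lt_ncard ⟨fun i hi => ?_, fun hs => hΦbot (hs h)⟩)
    have hij : i ≠ j := fun e => hΦbot (e ▸ hi)
    exact (heq i hij).trans hi
  have hiff : ∀ c : EReal, colExponent Φ j ≠ c → colExponent Ψ j ≠ c →
      {i | colExponent Φ i = c} = {i | colExponent Ψ i = c} := by
    intro c h1 h2
    ext i
    rcases eq_or_ne i j with rfl | hij
    · simp [h1, h2]
    · simp [heq i hij]
  refine (hsum (by rw [hiff ⊤ hΦtop hΨtop]) (by rw [hiff ⊥ hΦbot hΨbot])).not_gt ?_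
  refine Finset.sum_lt_sum (fun i _ => ?_) ⟨j, Finset.mem_univ j, ?_⟩
  · rcases eq_or_ne i j with rfl | hij
    · exact EReal.toReal_le_toReal hlt.le hΨbot hΦtop
    · rw [heq i hij]
  · rw [← EReal.coe_lt_coe_iff, EReal.coe_toReal hΨtop hΨbot, EReal.coe_toReal hΦtop hΦbot]
    exact hlt

/-- A normal fundamental matrix has at least as many columns of exponent less than `γ` as there
are independent solutions decaying faster than `exp (γ t)`. -/
theorem IsNormal.rank_le_ncard {A Φ : ℝ → Matrix (Fin n) (Fin n) ℝ} (hΦ : IsNormal A Φ)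
    {G : Matrix (Fin n) (Fin n) ℝ} {C β γ : ℝ} (hβ : β < γ)
    (hG : ∀ t : ℝ, 0 ≤ t → ‖Φ t * G‖ ≤ C * Real.exp (β * t)) :
    G.rank ≤ {j | colExponent Φ j < (γ : EReal)}.ncard := by
  classical
  -- If `G j k ≠ 0`, column `j` of `Φ` can be exchanged for column `k` of `Φ * G`, whose exponent is
  -- at most `β < γ`; normality forbids this when column `j` has exponent at least `γ`.
  have hzero : ∀ j, ¬ colExponent Φ j < (γ : EReal) → ∀ k, G j k = 0 := by
    intro j hj k
    by_contra hjk
    set U : Matrix (Fin n) (Fin n) ℝ := (1 : Matrix (Fin n) (Fin n) ℝ).updateCol j (G.col k)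
      with hU
    have hdet : U.det = G j k := by
      rw [hU, ← Matrix.cramer_apply, Matrix.cramer_one]
      simp [Matrix.col]
    have hUunit : IsUnit U := by
      rw [Matrix.isUnit_iff_isUnit_det, hdet]
      exact isUnit_iff_ne_zero.2 hjk
    have hΨ := hΦ.1.mul_const hUunit
    have hoff : ∀ i ≠ j, colExponent (fun t => Φ t * U) i = colExponent Φ i := by
      intro i hij
      have : ∀ t l, (Φ t * U) l i = Φ t l i := by
        intro t l
        simp [hU, Matrix.mul_apply, hij, Matrix.one_apply]
      simp only [colExponent, this]
    have hcol : ∀ t l, (Φ t * U) l j = (Φ t * G) l k := by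
      intro t l
      simp [hU, Matrix.mul_apply, Matrix.col]
    refine hj ((hΦ.colExponent_le_of_eq_off hΨ hoff).trans_lt (lt_of_le_of_lt ?_
      (EReal.coe_lt_coe_iff.2 hβ)))
    refine colExponent_le_of_norm_le (C := C) (fun t ht => ?_) (fun t ht => ?_)
    -- Positivity matters because `Real.log 0 = 0`; invertibility rules out a zero column.
    · rw [norm_pos_iff]
      intro h0
      have hd := (Matrix.isUnit_iff_isUnit_det _).1 (hΨ.2 t ht)
      refine hd.ne_zero (Matrix.det_eq_zero_of_column_eq_zero j fun i => ?_)
      simpa using congrArg (fun v : EuclideanSpace ℝ (Fin n) => v i) h0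
    · refine le_trans ?_ (hG t ht)
      simp only [hcol]
      have h := Matrix.l2_opNorm_mulVec (Φ t * G) (EuclideanSpace.single k (1 : ℝ))
      simp only [PiLp.norm_single, norm_one, mul_one] at h
      refine le_of_eq_of_le ?_ h
      congr 1
      ext l
      simp [Matrix.mulVec_single]
  -- The nonzero rows of `G` all have indices in the counted set, so a 0-1 diagonal matrix of that
  -- rank factors out.
  have hsupp : G = Matrix.diagonal
      (fun j => if colExponent Φ j < (γ : EReal) then (1 : ℝ) else 0) * G := by
    ext j k
    rw [Matrix.diagonal_mul]
    split_ifs with h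
    · simp
    · simp [hzero j h k]
  rw [hsupp]
  refine (Matrix.rank_mul_le_left _ _).trans (le_of_eq ?_)
  rw [Matrix.rank_diagonal, ← Nat.card_eq_fintype_card, ← Nat.card_coe_set_eq]
  refine Nat.card_congr (Equiv.subtypeEquivRight fun j => ?_)
  simp

theorem HasExpDichotomy.hasNonuniformExpDichotomy {A : ℝ → Matrix (Fin n) (Fin n) ℝ}
    (h : HasExpDichotomy A) : HasNonuniformExpDichotomy A := by
  obtain ⟨Φ, hΦ, P, hP, α, M, hα, hM, h1, h2⟩ := h
  exact ⟨Φ, hΦ, P, hP, α, M, 0, hα, hM, le_rfl, hα, by simpa using h1, by simpa using h2⟩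

theorem matrix_rank_add_le (P Q : Matrix (Fin n) (Fin n) ℝ) :
    (P + Q).rank ≤ P.rank + Q.rank := by
  have h := LinearMap.range_add_le P.mulVecLin Q.mulVecLin
  rw [← Matrix.mulVecLin_add] at h
  exact (Submodule.finrank_mono h).trans (Submodule.finrank_add_le_finrank_add_finrank _ _)

/-- Under a nonuniform dichotomy of the system shifted by `γ`, the numbers of upper exponents below
`γ` and of dual upper exponents below `-γ` add up to at least `n`. -/
theorem le_ncard_add_ncard {A X Y : ℝ → Matrix (Fin n) (Fin n) ℝ} {γ : ℝ}
    (hX : IsNormal A X) (hY : IsNormal (fun t => -(A t).transpose) Y)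
    (h : HasNonuniformExpDichotomy (fun t => A t - γ • (1 : Matrix (Fin n) (Fin n) ℝ))) :
    n ≤ {j | colExponent X j < (γ : EReal)}.ncard +
      {j | colExponent Y j < ((-γ : ℝ) : EReal)}.ncard := by
  obtain ⟨Φ, hΦ, P, -, α, M, ε, hα, hM, hε, hεα, h1, h2⟩ := h
  have hF := hΦ.exp_smul
  set K := (Y 0).transpose * X 0 with hK
  set L := (Y 0).transpose * (Real.exp (γ * 0) • Φ 0) with hL
  have hYT : ∀ t : ℝ, 0 ≤ t → IsUnit (Y t).transpose := fun t ht =>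
    (Matrix.isUnit_transpose _).2 (hY.1.2 t ht)
  have hKu : IsUnit K := (hYT 0 le_rfl).mul (hX.1.2 0 le_rfl)
  have hLu : IsUnit L := (hYT 0 le_rfl).mul (hF.2 0 le_rfl)
  have hKd := (Matrix.isUnit_iff_isUnit_det _).1 hKu
  have hLd := (Matrix.isUnit_iff_isUnit_det _).1 hLu
  -- Both sides have the same constant pairing with the invertible `Y`, so they agree without an
  -- appeal to uniqueness of solutions.
  have hXG : ∀ t : ℝ, 0 ≤ t → X t * (K⁻¹ * L * P) = Real.exp (γ * t) • (Φ t * P) := by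
    intro t ht
    have e1 : (Y t).transpose * X t = K := hX.1.transpose_mul_eq hY.1 ht
    have e2 : (Y t).transpose * (Real.exp (γ * t) • Φ t) = L := hF.transpose_mul_eq hY.1 ht
    refine (hYT t ht).mul_left_cancel ?_
    rw [← mul_assoc, e1, ← Matrix.smul_mul, ← mul_assoc (Y t).transpose, e2, ← mul_assoc,
      ← mul_assoc,
      Matrix.mul_nonsing_inv _ hKd, one_mul]
  have hYG : ∀ t : ℝ, 0 ≤ t → Y t * ((L.transpose)⁻¹ * (1 - P).transpose) =
      (Real.exp (-γ * t) • ((1 - P) * (Φ t)⁻¹)).transpose := by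
    intro t ht
    have e2 : (Y t).transpose * (Real.exp (γ * t) • Φ t) = L := hF.transpose_mul_eq hY.1 ht
    have hΦd := (Matrix.isUnit_iff_isUnit_det _).1 (hΦ.2 t ht)
    have e3 : (Y t).transpose = Real.exp (-γ * t) • (L * (Φ t)⁻¹) := by
      rw [← e2, mul_assoc, Matrix.smul_mul, Matrix.mul_nonsing_inv _ hΦd, Matrix.mul_smul,
        mul_one, smul_smul, ← Real.exp_add]
      simp
    refine Matrix.transpose_injective ?_
    rw [Matrix.transpose_transpose, Matrix.transpose_mul, e3, Matrix.transpose_mul,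
      Matrix.transpose_transpose, Matrix.transpose_nonsing_inv, Matrix.transpose_transpose,
      Matrix.mul_smul, mul_assoc, ← mul_assoc L⁻¹, Matrix.nonsing_inv_mul _ hLd, one_mul]
  have hΦ0 : IsUnit (Φ 0).det := (Matrix.isUnit_iff_isUnit_det _).1 (hΦ.2 0 le_rfl)
  have r1 : P.rank ≤ {j | colExponent X j < (γ : EReal)}.ncard := by
    have hr : (K⁻¹ * L * P).rank = P.rank :=
      Matrix.rank_mul_eq_right_of_isUnit_det _ _ (by
        rw [Matrix.det_mul]
        exact (Matrix.isUnit_nonsing_inv_det _ hKd).mul hLd)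
    rw [← hr]
    refine hX.rank_le_ncard (C := M * ‖Φ 0‖) (β := γ - α) (by linarith) fun t ht => ?_
    have e : Φ t * P = Φ t * P * (Φ 0)⁻¹ * Φ 0 := by
      rw [mul_assoc _ (Φ 0)⁻¹, Matrix.nonsing_inv_mul _ hΦ0, mul_one]
    have hb := h1 0 t le_rfl ht
    calc ‖X t * (K⁻¹ * L * P)‖ = Real.exp (γ * t) * ‖Φ t * P‖ := by
          rw [hXG t ht, norm_smul, Real.norm_of_nonneg (Real.exp_pos _).le]
      _ ≤ Real.exp (γ * t) * (‖Φ t * P * (Φ 0)⁻¹‖ * ‖Φ 0‖) := by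
          gcongr
          exact (congrArg norm e).le.trans (norm_mul_le _ _)
      _ ≤ Real.exp (γ * t) * (M * Real.exp (-α * (t - 0)) * Real.exp (ε * 0) * ‖Φ 0‖) := by
          gcongr
      _ = M * ‖Φ 0‖ * (Real.exp (γ * t) * Real.exp (-α * t)) := by
          simp only [sub_zero, mul_zero, Real.exp_zero]
          ring
      _ = M * ‖Φ 0‖ * Real.exp ((γ - α) * t) := by
          rw [← Real.exp_add]
          ring_nf
  have r2 : (1 - P).rank ≤ {j | colExponent Y j < ((-γ : ℝ) : EReal)}.ncard := by
    have hr : ((L.transpose)⁻¹ * (1 - P).transpose).rank = (1 - P).rank := by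
      rw [Matrix.rank_mul_eq_right_of_isUnit_det _ _ (Matrix.isUnit_nonsing_inv_det _ (by
        rwa [Matrix.det_transpose])), Matrix.rank_transpose]
    rw [← hr]
    -- Here the dichotomy is used from time `t` back to `0`, so the nonuniform factor `exp (ε t)`
    -- enters the rate; in the forward bound above it is `exp 0`.
    refine hY.rank_le_ncard (C := M * ‖(Φ 0)⁻¹‖) (β := -γ - α + ε) (by linarith) fun t ht => ?_
    have e : (1 - P) * (Φ t)⁻¹ = (Φ 0)⁻¹ * (Φ 0 * (1 - P) * (Φ t)⁻¹) := by
      rw [← mul_assoc, ← mul_assoc, Matrix.nonsing_inv_mul _ hΦ0, one_mul]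
    have hb := h2 t 0 le_rfl ht
    calc ‖Y t * ((L.transpose)⁻¹ * (1 - P).transpose)‖
        = Real.exp (-γ * t) * ‖(1 - P) * (Φ t)⁻¹‖ := by
          rw [hYG t ht, ← Matrix.conjTranspose_eq_transpose_of_trivial,
            Matrix.l2_opNorm_conjTranspose, norm_smul, Real.norm_of_nonneg (Real.exp_pos _).le]
      _ ≤ Real.exp (-γ * t) * (‖(Φ 0)⁻¹‖ * ‖Φ 0 * (1 - P) * (Φ t)⁻¹‖) := by
          gcongr
          exact (congrArg norm e).le.trans (norm_mul_le _ _)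
      _ ≤ Real.exp (-γ * t) *
          (‖(Φ 0)⁻¹‖ * (M * Real.exp (α * (0 - t)) * Real.exp (ε * t))) := by
          gcongr
      _ = M * ‖(Φ 0)⁻¹‖ * (Real.exp (-γ * t) * Real.exp (α * (0 - t)) * Real.exp (ε * t)) := by
          ring
      _ = M * ‖(Φ 0)⁻¹‖ * Real.exp ((-γ - α + ε) * t) := by
          rw [← Real.exp_add, ← Real.exp_add]
          ring_nf
  have r3 : n ≤ P.rank + (1 - P).rank := by
    have h := matrix_rank_add_le P (1 - P)
    rwa [add_sub_cancel, Matrix.rank_one, Fintype.card_fin] at h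
  omega

/-- If the `j`-th term of an antitone rearrangement is at least `c`, at most `n - 1 - j` terms lie
below `c`. -/
theorem ncard_lt_le_of_le_antitone {lam f : Fin n → EReal} (hlam : Antitone lam)
    {σ : Equiv.Perm (Fin n)} (hσ : ∀ j, lam j = f (σ j)) {c : EReal} {j : Fin n}
    (hj : c ≤ lam j) : {i | f i < c}.ncard ≤ n - 1 - j := by
  have hsub : {i | f i < c} ⊆ σ '' (Ioi j) := by
    intro i hi
    refine ⟨σ.symm i, ?_, by simp⟩
    -- A position at or before `j` carries a value at least `lam j ≥ c`.
    by_contra hle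
    have h1 := hlam (not_lt.1 hle)
    rw [hσ (σ.symm i), Equiv.apply_symm_apply] at h1
    exact (hj.trans h1).not_gt hi
  calc {i | f i < c}.ncard ≤ (σ '' (Ioi j)).ncard := Set.ncard_le_ncard hsub
    _ = (Ioi j).ncard := Set.ncard_image_of_injective _ σ.injective
    _ = n - 1 - j := by rw [← Finset.coe_Ioi, Set.ncard_coe_finset, Fin.card_Ioi]

end LinearODE

theorem mainTheorem1 (n : ℕ) (A : ℝ → Matrix (Fin n) (Fin n) ℝ)
    (hA : ContinuousOn A (Set.Ici 0)) :
    LinearODE.lyapunovSpectrum A ⊆ LinearODE.nonuniformExpDichotomySpectrum A ∧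
    LinearODE.nonuniformExpDichotomySpectrum A ⊆ LinearODE.expDichotomySpectrum A := by
  refine ⟨?_, fun γ hγ h => hγ h.hasNonuniformExpDichotomy⟩
  rintro γ ⟨lamInf, lamSup, ⟨mu, ⟨hmu, Y, hY, τ, hτ⟩, hmuInf⟩, ⟨hlam, X, hX, σ, hσ⟩, j, hj1, hj2⟩ h
  have hn := LinearODE.le_ncard_add_ncard hX hY h
  have c1 := LinearODE.ncard_lt_le_of_le_antitone hlam hσ hj2
  have hj3 : ((-γ : ℝ) : EReal) ≤ mu (Fin.rev j) := by
    rw [hmuInf j] at hj1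
    rw [EReal.coe_neg]
    exact EReal.neg_le.1 hj1
  -- Since `Fin.rev j` is `n - 1 - j`, this bound is `j`, and the two bounds total `n - 1 < n`.
  have c2 := LinearODE.ncard_lt_le_of_le_antitone hmu hτ hj3
  have := Fin.val_rev j
  omega
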